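/- Let $r\ge 1$ be an integer. An $r$-differential tower of groups is an infinite tower of finite groups $1=G_0\le G_1\le G_2\le\cdots$ such that the branching of complex irreducible characters from $G_n$ to $G_{n-1}$ is multiplicity-free for every $n\ge1$ and, as operators on the $\mathbb Z$-module of virtual characters of $G_n$, $$\mathrm{Res}^{G_{n+1}}_{G_n}\mathrm{Ind}_{G_n}^{G_{n+1}}-\mathrm{Ind}_{G_{n-1}}^{G_n}\mathrm{Res}^{G_n}_{G_{n-1}}=r\cdot\mathrm{id}\qquad(n\ge 0),$$ where for $n=0$ the second term on the left is omitted. Its associated poset $P$ has $n$-th rank $P_n=\mathrm{Irr}(G_n)$, the set of complex irreducible characters of $G_n$, and $\psi\in P_{n+1}$ covers $\chi\in P_n$ exactly when $\chi$ is a constituent of $\mathrm{Res}^{G_{n+1}}_{G_n}\psi$. Put $p_n=|P_n|$, let $U_n:\mathbb Z^{P_n}\to\mathbb Z^{P_{n+1}}$ send each basis element to the sum of the elements covering it, let $D_{n+1}:\mathbb Z^{P_{n+1}}\to\mathbb Z^{P_n}$ send each basis element to the sum of the elements it covers, and let $DU_n=D_{n+1}U_n$. For an integer $k$ and $m\ge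 0$ write $m!_{r,k}=(r+k)(2r+k)\cdots(mr+k)$, so that $0!_{r,k}=1$; also put $(-1)!_{1,k}=1$. A Smith form over $\mathbb Z$ of a square integer matrix $A$ is a diagonal matrix $PAQ$, with $P,Q$ invertible over $\mathbb Z$, whose diagonal entries satisfy $s_1\mid s_2\mid\cdots$; its entries are determined by $A$ up to sign. **Theorem.** Given an $r$-differential tower of groups, let $n\ge 0$, let $k\in\mathbb Z$, and let $A=DU_n+kI$. The matrix $A$ has a Smith form over $\mathbb Z$. Its last Smith entry $s_{p_n}$ is $0$ if $A$ is singular, and if $A$ is nonsingular then, up to sign, $$s_{p_n}=\begin{cases}(n+1)!_{r,k}&\text{if } r\ge 2,\\ (n-1)!_{1,k}\cdot(n+1+k)&\text{if } r=1.\end{cases}$$ -/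

import Mathlib

open scoped Matrix

noncomputable section

/-! ### Characters of finite groups -/

/-- The set `Irr(G)` of complex irreducible characters of a group `G`, which label the
finite-dimensional irreducible complex representations up to isomorphism. (Every
finite-dimensional complex representation is isomorphic to one on some `ℂ^d`.) -/
def IrrChar (G : Type*) [Group G] : Type _ :=
  {χ : G → ℂ // ∃ (d : ℕ) (ρ : Representation ℂ G (Fin d → ℂ)),
    ρ.IsIrreducible ∧ ρ.character = χ}

/-- The scalar product `⟨φ, χ⟩ = |G|⁻¹ ∑_g φ(g) χ(g⁻¹)`. For characters of a finite group
`χ(g⁻¹)` is the complex conjugate of `χ(g)`, and if `χ` is irreducible then `⟨φ, χ⟩` is the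
multiplicity of `χ` as a constituent of `φ`. -/
def charPairing {G : Type*} [Group G] [Fintype G] (φ χ : G → ℂ) : ℂ :=
  (Fintype.card G : ℂ)⁻¹ * ∑ g, φ g * χ g⁻¹

theorem charPairing_irrChar {G : Type*} [Group G] [Fintype G] (χ ψ : IrrChar G) :
    (χ = ψ → charPairing χ.1 ψ.1 = 1) ∧ (χ ≠ ψ → charPairing χ.1 ψ.1 = 0) := by
  obtain ⟨_, d, ρ, hρ, rfl⟩ := χ
  obtain ⟨_, e, σ, hσ, rfl⟩ := ψ
  have hc : (Nat.card G : ℂ) ≠ 0 := by simp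
  let _ : Invertible (Nat.card G : ℂ) := invertibleOfNonzero hc
  constructor
  · intro h
    have h' : ρ.character = σ.character := congrArg Subtype.val h
    have := Representation.char_orthonormal ρ ρ
    rw [if_pos ⟨Representation.Equiv.refl ρ⟩] at this
    simpa [charPairing, ← h', Nat.card_eq_fintype_card] using this
  · intro h
    have := Representation.char_orthonormal ρ σ
    rw [if_neg] at this
    · simpa [charPairing, Nat.card_eq_fintype_card] using this
    · rintro ⟨E⟩
      exact h (Subtype.ext (Representation.char_iso E).symm)

theorem finite_irrChar (G : Type*) [Group G] [Fintype G] : Finite (IrrChar G) := by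
  classical
  have hli : LinearIndependent ℂ (fun χ : IrrChar G => χ.1) := by
    rw [linearIndependent_iff']
    intro s c hc ψ hψ
    have h0 : charPairing (∑ χ ∈ s, c χ • χ.1) ψ.1 = 0 := by rw [hc]; simp [charPairing]
    have h1 : charPairing (∑ χ ∈ s, c χ • χ.1) ψ.1
        = ∑ χ ∈ s, c χ * charPairing χ.1 ψ.1 := by
      simp only [charPairing, Finset.sum_apply, Pi.smul_apply, smul_eq_mul, Finset.sum_mul,
        Finset.mul_sum]
      rw [Finset.sum_comm]
      refine Finset.sum_congr rfl fun χ _ => Finset.sum_congr rfl fun g _ => by ring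
    rw [h1, Finset.sum_eq_single ψ] at h0
    · simpa [(charPairing_irrChar ψ ψ).1 rfl] using h0
    · intro χ _ hχ
      rw [(charPairing_irrChar χ ψ).2 hχ, mul_zero]
    · exact fun h => absurd hψ h
  exact hli.finite

instance (G : Type*) [Group G] [Fintype G] : Fintype (IrrChar G) :=
  haveI := finite_irrChar G
  Fintype.ofFinite _

instance (G : Type*) [Group G] : DecidableEq (IrrChar G) := Classical.decEq _

/-- The `ℤ`-module of virtual characters of `G`: the `ℤ`-linear combinations of irreducible
characters. -/
def virtualChars (G : Type*) [Group G] : Submodule ℤ (G → ℂ) :=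
  Submodule.span ℤ (Set.range fun χ : IrrChar G => χ.1)

/-- Restriction of functions along a homomorphism `H →* G` (for us: the inclusion of a
subgroup). -/
def resChar {H G : Type*} [Group H] [Group G] (i : H →* G) (φ : G → ℂ) : H → ℂ :=
  fun h => φ (i h)

open Classical in
/-- Induction of class functions along an injective homomorphism `i : H →* G` of finite groups:
`(Ind φ)(g) = |H|⁻¹ ∑ φ(x⁻¹ g x)`, the sum being over the `x ∈ G` with `x⁻¹ g x ∈ H`. -/
def indChar {H G : Type*} [Group H] [Fintype H] [Group G] [Fintype G] (i : H →* G)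
    (φ : H → ℂ) : G → ℂ :=
  fun g => (Fintype.card H : ℂ)⁻¹ * ∑ x : G, ∑ h : H, if x⁻¹ * g * x = i h then φ h else 0

/-! ### Differential towers of groups and their posets -/

/-- `G 0 → G 1 → G 2 → ⋯` is an `r`-differential tower of finite groups: `r` is positive, `G 0`
is trivial, the maps are injective (so they identify `G n` with a subgroup of `G (n + 1)`), the
branching is multiplicity-free, and `Res ∘ Ind - Ind ∘ Res = r • id` on the virtual characters of
each `G n`, where for `n = 0` the term `Ind ∘ Res` is absent. -/
structure IsDifferentialTower (r : ℕ) {G : ℕ → Type*} [∀ n, Group (G n)] [∀ n, Fintype (G n)]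
    (i : ∀ n, G n →* G (n + 1)) : Prop where
  pos : 0 < r
  trivial : Subsingleton (G 0)
  injective : ∀ n, Function.Injective (i n)
  multiplicity_free : ∀ n (ψ : IrrChar (G (n + 1))) (χ : IrrChar (G n)),
    charPairing (resChar (i n) ψ.1) χ.1 = 0 ∨ charPairing (resChar (i n) ψ.1) χ.1 = 1
  res_ind_zero : ∀ φ ∈ virtualChars (G 0), resChar (i 0) (indChar (i 0) φ) = (r : ℂ) • φ
  res_ind_succ : ∀ n, ∀ φ ∈ virtualChars (G (n + 1)),
    resChar (i (n + 1)) (indChar (i (n + 1)) φ) - indChar (i n) (resChar (i n) φ) = (r : ℂ) • φ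

section Poset

variable {G : ℕ → Type*} [∀ n, Group (G n)] [∀ n, Fintype (G n)]

/-- The underlying set of the poset of a tower: the disjoint union of the ranks `Irr(G n)`. -/
def BranchingPoset (_i : ∀ n, G n →* G (n + 1)) : Type _ := Σ n, IrrChar (G n)

/-- The element of rank `n` of the poset labelled by `χ ∈ Irr(G n)`. -/
def BranchingPoset.elt (i : ∀ n, G n →* G (n + 1)) (n : ℕ) (χ : IrrChar (G n)) :
    BranchingPoset i := ⟨n, χ⟩

/-- The branching relation: `χ ∈ Irr(G n)` is below `ψ ∈ Irr(G (n + 1))` when `χ` is a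
constituent of the restriction of `ψ`. -/
inductive BranchingStep (i : ∀ n, G n →* G (n + 1)) : BranchingPoset i → BranchingPoset i → Prop
  | mk (n : ℕ) (χ : IrrChar (G n)) (ψ : IrrChar (G (n + 1)))
      (h : charPairing (resChar (i n) ψ.1) χ.1 ≠ 0) :
      BranchingStep i (BranchingPoset.elt i n χ) (BranchingPoset.elt i (n + 1) ψ)

theorem BranchingStep.rank_eq {i : ∀ n, G n →* G (n + 1)} {a b : BranchingPoset i}
    (h : BranchingStep i a b) : b.1 = a.1 + 1 := by
  cases h; rfl

theorem branching_rank {i : ∀ n, G n →* G (n + 1)} {a b : BranchingPoset i}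
    (h : Relation.ReflTransGen (BranchingStep i) a b) : a = b ∨ a.1 < b.1 := by
  induction h with
  | refl => exact Or.inl rfl
  | tail _ hs ih =>
    have := hs.rank_eq
    rcases ih with rfl | ih
    · right; omega
    · right; omega

/-- The partial order generated by the branching relation. -/
instance (i : ∀ n, G n →* G (n + 1)) : PartialOrder (BranchingPoset i) where
  le := Relation.ReflTransGen (BranchingStep i)
  le_refl _ := Relation.ReflTransGen.refl
  le_trans _ _ _ := Relation.ReflTransGen.trans
  le_antisymm a b hab hba := by
    rcases branching_rank hab with h | h
    · exact h
    · rcases branching_rank hba with h' | h'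
      · exact h'.symm
      · omega

/-- The covering relation of the poset is exactly the branching relation. -/
theorem branching_covBy_iff {i : ∀ n, G n →* G (n + 1)} {a b : BranchingPoset i} :
    a ⋖ b ↔ BranchingStep i a b := by
  constructor
  · intro h
    have hle : Relation.ReflTransGen (BranchingStep i) a b := h.le
    rcases Relation.ReflTransGen.cases_head hle with h' | ⟨c, hac, hcb⟩
    · exact absurd h' h.ne
    · have hac' : a < c := lt_of_le_of_ne (Relation.ReflTransGen.single hac) (by
        rintro rfl; have := hac.rank_eq; omega)
      rcases branching_rank hcb with rfl | hlt
      · exact hac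
      · exact absurd (lt_of_le_of_ne (show c ≤ b from hcb) (by rintro rfl; omega)) (h.2 hac')
  · intro h
    refine ⟨lt_of_le_of_ne (Relation.ReflTransGen.single h) ?_, ?_⟩
    · rintro rfl; have := h.rank_eq; omega
    · intro c hac hcb
      have h1 := (branching_rank (show Relation.ReflTransGen _ a c from hac.le)).resolve_left hac.ne
      have h2 := (branching_rank (show Relation.ReflTransGen _ c b from hcb.le)).resolve_left hcb.ne
      have := h.rank_eq
      omega

open Classical in
/-- The matrix of the up map `U_n : ℤ^{P_n} → ℤ^{P_{n+1}}`, which sends a basis element to the sum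
of the elements covering it. -/
def upMatrix (i : ∀ n, G n →* G (n + 1)) (n : ℕ) :
    Matrix (IrrChar (G (n + 1))) (IrrChar (G n)) ℤ :=
  Matrix.of fun ψ χ => if BranchingPoset.elt i n χ ⋖ BranchingPoset.elt i (n + 1) ψ then 1 else 0

open Classical in
/-- The matrix of the down map `D_{n+1} : ℤ^{P_{n+1}} → ℤ^{P_n}`, which sends a basis element to
the sum of the elements it covers. -/
def downMatrix (i : ∀ n, G n →* G (n + 1)) (n : ℕ) :
    Matrix (IrrChar (G n)) (IrrChar (G (n + 1))) ℤ :=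
  Matrix.of fun χ ψ => if BranchingPoset.elt i n χ ⋖ BranchingPoset.elt i (n + 1) ψ then 1 else 0

/-- The matrix of `DU_n = D_{n+1} U_n : ℤ^{P_n} → ℤ^{P_n}`. -/
def downUpMatrix (i : ∀ n, G n →* G (n + 1)) (n : ℕ) :
    Matrix (IrrChar (G n)) (IrrChar (G n)) ℤ :=
  downMatrix i n * upMatrix i n

end Poset

/-! ### Smith forms -/

/-- `s` is the last diagonal entry in a Smith form of the square matrix `A` over `R`: for some
invertible `P`, `Q`, the matrix `P A Q` is diagonal with entries `d 0 ∣ d 1 ∣ ⋯ ∣ d p = s`. Here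
`e` is a numbering of the index set of `A`. -/
def IsLastSmithEntry {ι R : Type*} [CommRing R] (A : Matrix ι ι R) (s : R) : Prop :=
  ∃ (p : ℕ) (e : ι ≃ Fin (p + 1)) (P Q : Matrix (Fin (p + 1)) (Fin (p + 1)) R)
    (d : Fin (p + 1) → R),
    IsUnit P ∧ IsUnit Q ∧ (∀ a b, a ≤ b → d a ∣ d b) ∧
      P * Matrix.reindex e e A * Q = Matrix.diagonal d ∧ d (Fin.last p) = s

/-- `m!_{r,k} = (r + k) (2r + k) ⋯ (mr + k)`, with `0!_{r,k} = 1`. -/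
def rkFactorial (r : ℕ) (k : ℤ) (m : ℕ) : ℤ :=
  ∏ l ∈ Finset.range m, (((l : ℤ) + 1) * (r : ℤ) + k)

end

/-! If `A` is nonsingular, its last Smith entry is, up to sign, the least positive `s` with `s A⁻¹`
integral. So if `A C = N` is scalar and some entry of `C` is a unit, that entry is `N` up to sign
(`IsLastSmithEntry.associated`). Everything reduces to finding such a `C` for `A = DU + k`.

By Frobenius reciprocity and multiplicity-freeness, `U` and `D` are induction and restriction in the
bases of irreducible characters, so the tower gives `DU = UD + r`. Hence `DU · U^j D^j = U^(j+1)
D^(j+1) + (j+1) r U^j D^j`, and a recursion produces `C_m`, a combination of the `U^j D^j` with `j <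
m`, such that `(DU + k) C_m` is `U^m D^m` minus a scalar. On rank `n` the term `U^(n+1) D^(n+1)`
vanishes, which settles the product formula. For `r = 1`, rank 1 is a single element, so `U^(n-1)
D^(n-1)` is already multiplied by `n + 1` under `DU`; one can stop earlier, and the factor `n + k`
is lost.

For the unit entry, a counting argument builds two chains, starting at distinct elements over a
common `c`, in which every element covers only its predecessor. At the pair of tops all lower `U^j
D^j` vanish, while the leading one has entry 1. -/

noncomputable section

/-! ### Smith forms of integer matrices -/

/-- Two square matrices are equivalent when one is obtained from the other by multiplication with
invertible matrices on both sides. -/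
def MatrixEquivalent {n : ℕ} (A B : Matrix (Fin n) (Fin n) ℤ) : Prop :=
  ∃ P Q : Matrix (Fin n) (Fin n) ℤ, IsUnit P ∧ IsUnit Q ∧ P * A * Q = B

namespace MatrixEquivalent

variable {n : ℕ} {A B C : Matrix (Fin n) (Fin n) ℤ}

theorem refl (A : Matrix (Fin n) (Fin n) ℤ) : MatrixEquivalent A A :=
  ⟨1, 1, isUnit_one, isUnit_one, by simp⟩

theorem trans (h : MatrixEquivalent A B) (h' : MatrixEquivalent B C) : MatrixEquivalent A C := by
  obtain ⟨P, Q, hP, hQ, rfl⟩ := h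
  obtain ⟨P', Q', hP', hQ', rfl⟩ := h'
  exact ⟨P' * P, Q * Q', hP'.mul hP, hQ.mul hQ', by simp only [mul_assoc]⟩

theorem smul (c : ℤ) (h : MatrixEquivalent A B) : MatrixEquivalent (c • A) (c • B) := by
  obtain ⟨P, Q, hP, hQ, rfl⟩ := h
  exact ⟨P, Q, hP, hQ, by rw [Matrix.mul_smul, Matrix.smul_mul]⟩

theorem left {P : Matrix (Fin n) (Fin n) ℤ} (hP : IsUnit P) (A : Matrix (Fin n) (Fin n) ℤ) :
    MatrixEquivalent A (P * A) := ⟨P, 1, hP, isUnit_one, by simp⟩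

theorem right {Q : Matrix (Fin n) (Fin n) ℤ} (hQ : IsUnit Q) (A : Matrix (Fin n) (Fin n) ℤ) :
    MatrixEquivalent A (A * Q) := ⟨1, Q, isUnit_one, hQ, by simp⟩

end MatrixEquivalent

theorem isUnit_transvection {n : ℕ} {i j : Fin n} (hij : i ≠ j) (c : ℤ) :
    IsUnit (Matrix.transvection i j c) := by
  rw [Matrix.isUnit_iff_isUnit_det, Matrix.det_transvection_of_ne i j hij]
  exact isUnit_one

/-- If `g` is a nonzero entry of smallest absolute value among all matrices equivalent to `C`, then
it divides the other entries in its column. -/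
theorem entry_dvd_column {n : ℕ} {C : Matrix (Fin n) (Fin n) ℤ} {i₀ j₀ : Fin n}
    (hg : C i₀ j₀ ≠ 0)
    (hmin : ∀ B, MatrixEquivalent C B → ∀ i j, B i j ≠ 0 → (C i₀ j₀).natAbs ≤ (B i j).natAbs)
    (i : Fin n) : C i₀ j₀ ∣ C i j₀ := by
  by_cases hi : i = i₀
  · rw [hi]
  by_contra hd
  -- A row operation replaces the entry by its remainder modulo the pivot, which would be a smaller
  -- nonzero entry.
  have hval : (Matrix.transvection i i₀ (-(C i j₀ / C i₀ j₀)) * C) i j₀ = C i j₀ % C i₀ j₀ := by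
    rw [Matrix.transvection_mul_apply_same, Int.emod_def]
    ring
  have hne : C i j₀ % C i₀ j₀ ≠ 0 := fun h => hd (Int.dvd_of_emod_eq_zero h)
  have := hmin _ (MatrixEquivalent.left (isUnit_transvection hi _) C) i j₀ (by rwa [hval])
  rw [hval] at this
  have h1 := Int.emod_nonneg (C i j₀) hg
  have h2 := Int.emod_lt_abs (C i j₀) hg
  rw [Int.abs_eq_natAbs] at h2
  omega

theorem entry_dvd_row {n : ℕ} {C : Matrix (Fin n) (Fin n) ℤ} {i₀ j₀ : Fin n}
    (hg : C i₀ j₀ ≠ 0)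
    (hmin : ∀ B, MatrixEquivalent C B → ∀ i j, B i j ≠ 0 → (C i₀ j₀).natAbs ≤ (B i j).natAbs)
    (j : Fin n) : C i₀ j₀ ∣ C i₀ j := by
  by_cases hj : j = j₀
  · rw [hj]
  by_contra hd
  have hval : (C * Matrix.transvection j₀ j (-(C i₀ j / C i₀ j₀))) i₀ j = C i₀ j % C i₀ j₀ := by
    rw [Matrix.mul_transvection_apply_same, Int.emod_def]
    ring
  have hne : C i₀ j % C i₀ j₀ ≠ 0 := fun h => hd (Int.dvd_of_emod_eq_zero h)
  have := hmin _ (MatrixEquivalent.right (isUnit_transvection (Ne.symm hj) _) C) i₀ j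
    (by rwa [hval])
  rw [hval] at this
  have h1 := Int.emod_nonneg (C i₀ j) hg
  have h2 := Int.emod_lt_abs (C i₀ j) hg
  rw [Int.abs_eq_natAbs] at h2
  omega

/-- Clear the entry of row `i` in the pivot column, then add that row to the pivot row. The pivot is
unchanged and still minimal, so it divides the new pivot row, and hence row `i`. -/
theorem entry_dvd {n : ℕ} {C : Matrix (Fin n) (Fin n) ℤ} {i₀ j₀ : Fin n}
    (hg : C i₀ j₀ ≠ 0)
    (hmin : ∀ B, MatrixEquivalent C B → ∀ i j, B i j ≠ 0 → (C i₀ j₀).natAbs ≤ (B i j).natAbs)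
    (i j : Fin n) : C i₀ j₀ ∣ C i j := by
  by_cases hi : i = i₀
  · rw [hi]; exact entry_dvd_row hg hmin j
  obtain ⟨q, hq⟩ := entry_dvd_column hg hmin i
  set C' := Matrix.transvection i i₀ (-q) * C with hC'
  set C'' := Matrix.transvection i₀ i 1 * C' with hC''
  have e1 : ∀ b, C' i b = C i b - q * C i₀ b := fun b => by
    rw [hC', Matrix.transvection_mul_apply_same]; ring
  have e2 : ∀ b, C' i₀ b = C i₀ b := fun b => by
    rw [hC', Matrix.transvection_mul_apply_of_ne _ _ _ _ (Ne.symm hi)]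
  have e3 : ∀ b, C'' i₀ b = C i₀ b + (C i b - q * C i₀ b) := fun b => by
    rw [hC'', Matrix.transvection_mul_apply_same, e1, e2]; ring
  have hCC : MatrixEquivalent C C'' :=
    (MatrixEquivalent.left (isUnit_transvection hi _) C).trans
      (MatrixEquivalent.left (isUnit_transvection (Ne.symm hi) _) C')
  have e4 : C'' i₀ j₀ = C i₀ j₀ := by rw [e3, hq]; ring
  have hrow := entry_dvd_row (C := C'') (i₀ := i₀) (j₀ := j₀) (by rwa [e4])
    (fun B hB a b hab => by rw [e4]; exact hmin B (hCC.trans hB) a b hab) j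
  rw [e4, e3] at hrow
  have hrow' := entry_dvd_row hg hmin j
  have : C i j = C i₀ j + (C i j - q * C i₀ j) - C i₀ j + q * C i₀ j := by ring
  rw [this]
  exact dvd_add (dvd_sub hrow hrow') (hrow'.mul_left q)

/-- The matrix with corner `a`, first row `u`, first column `v` and remaining part `D`. -/
def borderedMatrix {n : ℕ} (a : ℤ) (u v : Fin n → ℤ) (D : Matrix (Fin n) (Fin n) ℤ) :
    Matrix (Fin (n + 1)) (Fin (n + 1)) ℤ :=
  Matrix.of (Fin.cons (Fin.cons a u) fun i => Fin.cons (v i) (D i))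

section bordered

variable {n : ℕ} (a : ℤ) (u v : Fin n → ℤ) (D : Matrix (Fin n) (Fin n) ℤ)

@[simp] theorem borderedMatrix_zero_zero : borderedMatrix a u v D 0 0 = a := rfl
@[simp] theorem borderedMatrix_zero_succ (j : Fin n) : borderedMatrix a u v D 0 j.succ = u j := rfl
@[simp] theorem borderedMatrix_succ_zero (i : Fin n) : borderedMatrix a u v D i.succ 0 = v i := rfl
@[simp] theorem borderedMatrix_succ_succ (i j : Fin n) :
    borderedMatrix a u v D i.succ j.succ = D i j := rfl

theorem borderedMatrix_mul (a' : ℤ) (u' v' : Fin n → ℤ) (D' : Matrix (Fin n) (Fin n) ℤ) :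
    borderedMatrix a u v D * borderedMatrix a' u' v' D' =
      borderedMatrix (a * a' + u ⬝ᵥ v') (a • u' + u ᵥ* D') (a' • v + D *ᵥ v')
        (Matrix.vecMulVec v u' + D * D') := by
  ext i j
  refine Fin.cases ?_ (fun i => ?_) i <;> refine Fin.cases ?_ (fun j => ?_) j <;>
    simp [Matrix.mul_apply, Fin.sum_univ_succ, dotProduct, Matrix.vecMul, Matrix.mulVec,
      Matrix.vecMulVec_apply, mul_comm]

theorem det_borderedMatrix_of_row_eq_zero : (borderedMatrix a 0 v D).det = a * D.det := by
  rw [Matrix.det_succ_row_zero, Fin.sum_univ_succ]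
  simp only [borderedMatrix_zero_zero, borderedMatrix_zero_succ, Pi.zero_apply, mul_zero, zero_mul,
    Finset.sum_const_zero, add_zero, Fin.val_zero, pow_zero, one_mul]
  congr 2

theorem isUnit_borderedMatrix {D : Matrix (Fin n) (Fin n) ℤ} (hD : IsUnit D) :
    IsUnit (borderedMatrix 1 0 v D) := by
  rw [Matrix.isUnit_iff_isUnit_det] at hD ⊢
  rwa [det_borderedMatrix_of_row_eq_zero, one_mul]

theorem isUnit_borderedMatrix' {D : Matrix (Fin n) (Fin n) ℤ} (hD : IsUnit D) :
    IsUnit (borderedMatrix 1 u 0 D) := by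
  have h : (borderedMatrix 1 u 0 D)ᵀ = borderedMatrix 1 0 u Dᵀ := by
    ext i j
    refine Fin.cases ?_ (fun i => ?_) i <;> refine Fin.cases ?_ (fun j => ?_) j <;> simp
  rw [Matrix.isUnit_iff_isUnit_det] at hD ⊢
  rw [← Matrix.det_transpose, h, det_borderedMatrix_of_row_eq_zero, Matrix.det_transpose, one_mul]
  exact hD

end bordered

theorem isUnit_swapMatrix {n : ℕ} (a b : Fin n) : IsUnit (Matrix.swap ℤ a b) :=
  ⟨⟨_, _, Matrix.swap_mul_self a b, Matrix.swap_mul_self a b⟩, rfl⟩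

/-- Every square integer matrix has a Smith form. -/
theorem exists_smith_form (n : ℕ) (A : Matrix (Fin n) (Fin n) ℤ) :
    ∃ d : Fin n → ℤ, (∀ a b, a ≤ b → d a ∣ d b) ∧ MatrixEquivalent A (Matrix.diagonal d) := by
  classical
  induction n with
  | zero => exact ⟨0, fun a => a.elim0, by
      rw [Subsingleton.elim (Matrix.diagonal 0) A]; exact .refl A⟩
  | succ n ih =>
    by_cases hA : A = 0
    · exact ⟨0, fun _ _ _ => dvd_rfl, by subst hA; convert MatrixEquivalent.refl _; simp⟩
    have hex : ∃ m : ℕ, ∃ B, MatrixEquivalent A B ∧ ∃ i j, B i j ≠ 0 ∧ (B i j).natAbs = m := by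
      obtain ⟨i, j, hij⟩ : ∃ i j, A i j ≠ 0 := by
        by_contra! h
        exact hA (Matrix.ext h)
      exact ⟨_, A, .refl A, i, j, hij, rfl⟩
    obtain ⟨B, hAB, i₀, j₀, hne, hm⟩ := Nat.find_spec hex
    have hmin : ∀ C, MatrixEquivalent B C → ∀ i j, C i j ≠ 0 →
        (B i₀ j₀).natAbs ≤ (C i j).natAbs := fun C hC i j hij => by
      rw [hm]
      exact Nat.find_min' hex ⟨C, hAB.trans hC, i, j, hij, rfl⟩
    have hdvd := entry_dvd hne hmin
    set g := B i₀ j₀ with hg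
    choose E hE using hdvd
    have hBE : B = g • Matrix.of E := by
      ext i j
      simpa using hE i j
    have hE1 : E i₀ j₀ = 1 := by
      have := hE i₀ j₀
      rw [← hg] at this
      exact mul_left_cancel₀ hne (by rw [← this, mul_one])
    set F := Matrix.swap ℤ 0 i₀ * Matrix.of E * Matrix.swap ℤ 0 j₀ with hF
    have hEF : MatrixEquivalent (Matrix.of E) F :=
      ⟨_, _, isUnit_swapMatrix _ _, isUnit_swapMatrix _ _, rfl⟩
    have hF1 : F 0 0 = 1 := by
      rw [hF, Matrix.mul_swap_apply_left, Matrix.swap_mul_apply_left]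
      exact hE1
    set u : Fin n → ℤ := fun j => F 0 j.succ
    set v : Fin n → ℤ := fun i => F i.succ 0
    set D : Matrix (Fin n) (Fin n) ℤ := Matrix.of fun i j => F i.succ j.succ
    have hFb : F = borderedMatrix 1 u v D := by
      ext i j
      refine Fin.cases ?_ (fun i => ?_) i <;> refine Fin.cases ?_ (fun j => ?_) j <;>
        simp [hF1, u, v, D]
    -- Clearing the row and column of the corner 1 leaves this Schur complement. The pivot `g`,
    -- factored out of the whole matrix, is put back at the end, so it divides every later diagonal
    -- entry.
    obtain ⟨d, hd, P, Q, hP, hQ, hPQ⟩ := ih (D - Matrix.vecMulVec v u)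
    have hclear : MatrixEquivalent F (borderedMatrix 1 0 0 (D - Matrix.vecMulVec v u)) := by
      refine ⟨borderedMatrix 1 0 (-v) 1, borderedMatrix 1 (-u) 0 1,
        isUnit_borderedMatrix _ isUnit_one, isUnit_borderedMatrix' _ isUnit_one, ?_⟩
      rw [hFb, borderedMatrix_mul, borderedMatrix_mul]
      congr 1
      · simp
      · simp
      · simp
      · simp [Matrix.neg_vecMulVec]; abel
    have hdiag : MatrixEquivalent (borderedMatrix 1 0 0 (D - Matrix.vecMulVec v u))
        (borderedMatrix 1 0 0 (Matrix.diagonal d)) := by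
      refine ⟨borderedMatrix 1 0 0 P, borderedMatrix 1 0 0 Q,
        isUnit_borderedMatrix _ hP, isUnit_borderedMatrix _ hQ, ?_⟩
      rw [borderedMatrix_mul, borderedMatrix_mul, ← hPQ]
      congr 1 <;> simp
    refine ⟨Fin.cons g fun i => g * d i, ?_, ?_⟩
    · intro a b
      refine Fin.cases ?_ (fun a => ?_) a <;> refine Fin.cases ?_ (fun b => ?_) b
      · simp
      · simp
      · intro h; simp at h
      · intro h
        simpa using mul_dvd_mul_left g (hd a b (by simpa using h))
    · have h := hAB.trans (hBE ▸ ((hEF.trans (hclear.trans hdiag)).smul g))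
      convert h using 1
      ext i j
      refine Fin.cases ?_ (fun i => ?_) i <;> refine Fin.cases ?_ (fun j => ?_) j <;>
        simp [Matrix.diagonal_apply, Fin.succ_ne_zero, (Fin.succ_ne_zero _).symm]

/-! ### The last Smith entry -/

section LastEntry

variable {ι : Type*}

theorem exists_isLastSmithEntry [Fintype ι] [Nonempty ι] (A : Matrix ι ι ℤ) : ∃ s, IsLastSmithEntry A s := by
  obtain ⟨p, hp⟩ : ∃ p, Fintype.card ι = p + 1 :=
    Nat.exists_eq_succ_of_ne_zero Fintype.card_ne_zero
  let e : ι ≃ Fin (p + 1) := Fintype.equivFinOfCardEq hp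
  obtain ⟨d, hd, P, Q, hP, hQ, h⟩ := exists_smith_form _ (Matrix.reindex e e A)
  exact ⟨_, p, e, P, Q, d, hP, hQ, hd, h, rfl⟩

/-- The unit is absorbed into `Q` as a scalar matrix. -/
theorem IsLastSmithEntry.of_associated {A : Matrix ι ι ℤ} {s t : ℤ} (h : IsLastSmithEntry A s)
    (hst : Associated s t) : IsLastSmithEntry A t := by
  obtain ⟨p, e, P, Q, d, hP, hQ, hd, hdiag, rfl⟩ := h
  obtain ⟨u, rfl⟩ := hst
  refine ⟨p, e, P, Q * Matrix.diagonal fun _ => (u : ℤ), fun a => d a * u, hP, hQ.mul ?_, ?_, ?_,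
    rfl⟩
  · rw [Matrix.isUnit_iff_isUnit_det, Matrix.det_diagonal]
    simp
  · exact fun a b hab => mul_dvd_mul_right (hd a b hab) _
  · rw [← mul_assoc, hdiag, Matrix.diagonal_mul_diagonal]

variable [Fintype ι] [DecidableEq ι]

theorem IsLastSmithEntry.eq_zero_iff {A : Matrix ι ι ℤ} {s : ℤ} (h : IsLastSmithEntry A s) :
    s = 0 ↔ A.det = 0 := by
  obtain ⟨p, e, P, Q, d, hP, hQ, hd, hdiag, rfl⟩ := h
  have hdet := congrArg Matrix.det hdiag
  rw [Matrix.det_mul, Matrix.det_mul, Matrix.det_reindex_self, Matrix.det_diagonal] at hdet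
  rw [Matrix.isUnit_iff_isUnit_det] at hP hQ
  have hA : A.det = 0 ↔ ∏ a, d a = 0 := by
    rw [← hdet]
    simp [hP.ne_zero, hQ.ne_zero]
  rw [hA, Finset.prod_eq_zero_iff]
  constructor
  · exact fun h => ⟨_, Finset.mem_univ _, h⟩
  · rintro ⟨a, -, ha⟩
    have := hd a (Fin.last p) (Fin.le_last a)
    rwa [ha, zero_dvd_iff] at this

/-- If `A C = N` with `N` a scalar and `C` has an entry that is a unit, then `N` is the last Smith
entry of `A`. -/
theorem IsLastSmithEntry.associated {A C : Matrix ι ι ℤ} {s N : ℤ} (h : IsLastSmithEntry A s)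
    (hdet : A.det ≠ 0) (hC : A * C = N • 1) {x y : ι} (hxy : IsUnit (C x y)) :
    Associated s N := by
  obtain ⟨p, e, P, Q, d, hP, hQ, hd, hdiag, rfl⟩ := h
  set A' := Matrix.reindex e e A with hA'
  set C' := Matrix.reindex e e C with hC'
  have hAC : A' * C' = N • 1 := by
    have := congrArg (Matrix.reindexAlgEquiv ℤ ℤ e) hC
    simpa only [map_mul, map_smul, map_one, Matrix.coe_reindexAlgEquiv] using this
  obtain ⟨P, rfl⟩ := hP
  obtain ⟨Q, rfl⟩ := hQ
  have hdet' : A'.det ≠ 0 := by rwa [hA', Matrix.det_reindex_self]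
  have hA'' : A' = (P⁻¹).val * Matrix.diagonal d * (Q⁻¹).val := by
    rw [← hdiag]
    simp [mul_assoc]
  apply associated_of_dvd_dvd
  -- The last diagonal entry of this identity exhibits `N` as a multiple of `d (Fin.last p)`.
  · have h1 : Matrix.diagonal d * ((Q⁻¹).val * C' * (P⁻¹).val) = N • 1 := by
      calc Matrix.diagonal d * ((Q⁻¹).val * C' * (P⁻¹).val)
          = P.val * ((P⁻¹).val * Matrix.diagonal d * (Q⁻¹).val * C') * (P⁻¹).val := by simp [mul_assoc]
        _ = N • 1 := by rw [← hA'', hAC, Matrix.mul_smul, Matrix.smul_mul, mul_one, Units.mul_inv]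
    have h2 := congrFun (congrFun h1 (Fin.last p)) (Fin.last p)
    rw [Matrix.diagonal_mul] at h2
    exact ⟨_, by simpa using h2.symm⟩
  -- The quotients of the last Smith entry by the others give an integral `E` with `A' E` equal to
  -- that entry. Cancelling `A'` yields `N E = d (Fin.last p) C'`, and the unit entry of `C'` shows
  -- that `N` divides `d (Fin.last p)`.
  · choose c hc using fun a => hd a (Fin.last p) (Fin.le_last a)
    set E : Matrix (Fin (p + 1)) (Fin (p + 1)) ℤ := Q.val * Matrix.diagonal c * P.val
    have hAE : A' * E = d (Fin.last p) • 1 := by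
      have hdc : Matrix.diagonal d * Matrix.diagonal c = d (Fin.last p) • 1 := by
        rw [Matrix.diagonal_mul_diagonal, Matrix.smul_one_eq_diagonal]
        congr 1
        funext a
        exact (hc a).symm
      calc A' * E = (P⁻¹).val * (Matrix.diagonal d * Matrix.diagonal c) * P.val := by
            rw [hA'']; simp only [E, mul_assoc, Units.inv_mul_cancel_left]
        _ = _ := by rw [hdc, Matrix.mul_smul, Matrix.smul_mul, mul_one, Units.inv_mul]
    have hEC : N • E = d (Fin.last p) • C' := by
      have hz : A' * (N • E - d (Fin.last p) • C') = 0 := by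
        rw [mul_sub, mul_smul_comm, mul_smul_comm, hAE, hAC, smul_smul, smul_smul, mul_comm,
          sub_self]
      have := congrArg (A'.adjugate * ·) hz
      simp only [← mul_assoc, Matrix.adjugate_mul, mul_zero, smul_mul_assoc, one_mul] at this
      exact sub_eq_zero.mp ((smul_eq_zero.mp this).resolve_left hdet')
    have hent := congrFun (congrFun hEC (e x)) (e y)
    simp only [Matrix.smul_apply, smul_eq_mul, hC', Matrix.reindex_apply, Matrix.submatrix_apply,
      Equiv.symm_apply_apply] at hent
    exact (hxy.dvd_mul_right).mp ⟨_, hent.symm⟩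

theorem isLastSmithEntry_iff_associated [Nonempty ι] {A C : Matrix ι ι ℤ} {N : ℤ}
    (hdet : A.det ≠ 0) (hC : A * C = N • 1) {x y : ι} (hxy : IsUnit (C x y)) (s : ℤ) :
    IsLastSmithEntry A s ↔ Associated s N := by
  refine ⟨fun h => h.associated hdet hC hxy, fun h => ?_⟩
  obtain ⟨t, ht⟩ := exists_isLastSmithEntry A
  exact ht.of_associated ((ht.associated hdet hC hxy).trans h.symm)

theorem isLastSmithEntry_iff_eq_zero [Nonempty ι] {A : Matrix ι ι ℤ} (hdet : A.det = 0) (s : ℤ) :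
    IsLastSmithEntry A s ↔ s = 0 := by
  refine ⟨fun h => h.eq_zero_iff.mpr hdet, ?_⟩
  rintro rfl
  obtain ⟨t, ht⟩ := exists_isLastSmithEntry A
  rwa [ht.eq_zero_iff.mpr hdet] at ht

end LastEntry

/-! ### Differential posets -/

/-- The covering matrices of an `r`-differential graded poset with ranks `P 0, P 1, …`. The entry of
`M n` at `(y, x)` is `1` if `y` covers `x`, and `0` otherwise. -/
structure IsDifferentialPoset (r : ℕ) {P : ℕ → Type*} [∀ n, Fintype (P n)] [∀ n, DecidableEq (P n)]
    (M : ∀ n, Matrix (P (n + 1)) (P n) ℤ) : Prop where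
  pos : 0 < r
  card_zero : Fintype.card (P 0) = 1
  zero_or_one : ∀ n y x, M n y x = 0 ∨ M n y x = 1
  exists_lower : ∀ n y, ∃ x, M n y x = 1
  down_up_zero : (M 0)ᵀ * M 0 = (r : ℤ) • 1
  down_up_succ : ∀ n, (M (n + 1))ᵀ * M (n + 1) = M n * (M n)ᵀ + (r : ℤ) • 1

/-! ### The operators `U^j D^j` and their combinations -/

section UpDown

variable {P : ℕ → Type*} [∀ n, Fintype (P n)] [∀ n, DecidableEq (P n)]
  (M : ∀ n, Matrix (P (n + 1)) (P n) ℤ)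

/-- The matrix of `U ^ j D ^ j` on rank `n`. -/
def upDownPow : ∀ _j n : ℕ, Matrix (P n) (P n) ℤ
  | 0, _ => 1
  | _ + 1, 0 => 0
  | j + 1, n + 1 => M n * upDownPow j n * (M n)ᵀ

/-- The matrices `C m` with `(DU + k) * C m = U ^ m D ^ m - (-1) ^ m (r + k) ⋯ (m r + k)`. -/
def shiftedInverse (r : ℕ) (k : ℤ) (n : ℕ) : ℕ → Matrix (P n) (P n) ℤ
  | 0 => 0
  | m + 1 => upDownPow M m n - (((m : ℤ) + 1) * r + k) • shiftedInverse r k n m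

/-- `w` covers only `j`. -/
def CoversOnly {n : ℕ} (w : P (n + 1)) (j : P n) : Prop :=
  ∀ x, M n w x = if x = j then 1 else 0

@[simp] theorem upDownPow_zero (n : ℕ) : upDownPow M 0 n = 1 := by cases n <;> rfl

theorem upDownPow_eq_zero {j n : ℕ} (h : n < j) : upDownPow M j n = 0 := by
  induction n generalizing j with
  | zero => obtain ⟨j, rfl⟩ := Nat.exists_eq_succ_of_ne_zero h.ne'; rfl
  | succ n ih =>
    obtain ⟨j, rfl⟩ := Nat.exists_eq_succ_of_ne_zero (Nat.ne_zero_of_lt h)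
    simp [upDownPow, ih (Nat.lt_of_succ_lt_succ h)]

/-- Every chain descending from `w` or `z` must start through `x` or `y`, so one level can be
stripped off. -/
theorem upDownPow_succ_apply {j n : ℕ} {w z : P (n + 1)} {x y : P n} (hw : CoversOnly M w x)
    (hz : CoversOnly M z y) : upDownPow M (j + 1) (n + 1) w z = upDownPow M j n x y := by
  have h1 : ∀ b, (M n * upDownPow M j n) w b = upDownPow M j n x b := fun b => by
    simp [Matrix.mul_apply, hw _]
  simp [upDownPow, Matrix.mul_apply (M := M n * upDownPow M j n), h1, hz _]

/-- `shiftedInverse M r k n m` is a combination of the `U^j D^j` with `j < m`. -/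
theorem shiftedInverse_apply_eq_zero (r : ℕ) (k : ℤ) {n d : ℕ} {x y : P n}
    (h : ∀ j < d, upDownPow M j n x y = 0) {m : ℕ} (hm : m ≤ d) :
    shiftedInverse M r k n m x y = 0 := by
  induction m with
  | zero => rfl
  | succ m ih => simp [-zsmul_eq_mul, shiftedInverse, h m (by omega), ih (by omega)]

end UpDown

namespace IsDifferentialPoset

variable {r : ℕ} {P : ℕ → Type*} [∀ n, Fintype (P n)] [∀ n, DecidableEq (P n)]
  {M : ∀ n, Matrix (P (n + 1)) (P n) ℤ} (hM : IsDifferentialPoset r M)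
include hM

/-- Replacing `DU` by `UD + r` leaves `U (DU · U^j D^j) D` one rank lower plus `r` times the
original, so each level passed contributes one `r`. -/
theorem down_up_mul_upDownPow (j n : ℕ) :
    (M n)ᵀ * M n * upDownPow M j n =
      upDownPow M (j + 1) n + (((j : ℤ) + 1) * r) • upDownPow M j n := by
  induction n generalizing j with
  | zero =>
    cases j with
    | zero => simp [hM.down_up_zero, upDownPow]
    | succ j => simp [upDownPow]
  | succ n ih =>
    rw [hM.down_up_succ]
    cases j with
    | zero => simp [upDownPow]
    | succ j =>
      calc (M n * (M n)ᵀ + (r : ℤ) • 1) * upDownPow M (j + 1) (n + 1)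
          = M n * ((M n)ᵀ * M n * upDownPow M j n) * (M n)ᵀ
            + (r : ℤ) • upDownPow M (j + 1) (n + 1) := by
            simp only [add_mul, upDownPow, smul_mul_assoc, one_mul, Matrix.mul_assoc]
        _ = _ := by
            rw [ih]
            simp only [upDownPow, Matrix.mul_add, Matrix.add_mul, Matrix.mul_smul, Matrix.smul_mul]
            push_cast
            module

/-- The coefficient in the recursion is chosen so that the `U^m D^m` terms cancel at each step. -/
theorem add_mul_shiftedInverse (k : ℤ) (n m : ℕ) :
    ((M n)ᵀ * M n + k • (1 : Matrix (P n) (P n) ℤ)) * shiftedInverse M r k n m =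
      upDownPow M m n - ((-1) ^ m * rkFactorial r k m) • 1 := by
  induction m with
  | zero => simp [shiftedInverse, rkFactorial]
  | succ m ih =>
    rw [shiftedInverse, mul_sub, mul_smul_comm, ih, add_mul, hM.down_up_mul_upDownPow]
    simp only [rkFactorial, Finset.prod_range_succ, smul_mul_assoc, one_mul]
    module

/-! ### Chains of elements that cover only one element -/

theorem sum_upper_mul_lower {n : ℕ} (j x : P (n + 1)) {c : P n} (hj : CoversOnly M j c) :
    ∑ w, M (n + 1) w j * M (n + 1) w x = M n x c + if j = x then (r : ℤ) else 0 := by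
  -- Entry `(j, x)` of `DU = UD + r`; since `j` covers only `c`, the `UD` sum has one term.
  have h := congrFun (congrFun (hM.down_up_succ n) j) x
  rw [Matrix.add_apply, Matrix.smul_apply] at h
  simpa [Matrix.mul_apply, Matrix.one_apply, hj _] using h

theorem nonneg {n : ℕ} (y : P (n + 1)) (x : P n) : 0 ≤ M n y x := by
  rcases hM.zero_or_one n y x with h | h <;> simp [h]

theorem mul_self {n : ℕ} (y : P (n + 1)) (x : P n) : M n y x * M n y x = M n y x := by
  rcases hM.zero_or_one n y x with h | h <;> simp [h]

theorem sum_upper_of_coversOnly {n : ℕ} {j : P (n + 1)} {c : P n} (hj : CoversOnly M j c) :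
    ∑ w, M (n + 1) w j = r + 1 := by
  have h := hM.sum_upper_mul_lower j j hj
  simp only [hM.mul_self, hj c, if_true] at h
  rw [h, add_comm]

/-- An element that covers only `c`, with `c` covered by at most `r + 1` elements, is itself the only
element covered by some element. -/
theorem exists_coversOnly {n : ℕ} {j : P (n + 1)} {c : P n} (hj : CoversOnly M j c)
    (hc : ∑ y, M n y c ≤ r + 1) : ∃ w, CoversOnly M w j := by
  by_contra! hno
  have hdeg : ∀ w, M (n + 1) w j = 1 → 2 ≤ ∑ x, M (n + 1) w x := by
    intro w hw
    have hne := hno w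
    unfold CoversOnly at hne
    push Not at hne
    obtain ⟨x, hx⟩ := hne
    have hxj : x ≠ j := by
      rintro rfl
      simp [hw] at hx
    rw [if_neg hxj] at hx
    have hx1 := (hM.zero_or_one _ w x).resolve_left hx
    calc (2 : ℤ) = ∑ z ∈ {x, j}, M (n + 1) w z := by
          rw [Finset.sum_pair hxj, hx1, hw]; norm_num
      _ ≤ _ := Finset.sum_le_sum_of_subset_of_nonneg (Finset.subset_univ _)
          fun z _ _ => hM.nonneg w z
  -- Count the elements covered by the `r + 1` upper covers of `j`, with multiplicity. The total is
  -- at most `2r + 1`, whereas at least two under each cover would give `2r + 2`.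
  have h1 : ∑ w, M (n + 1) w j * ∑ x, M (n + 1) w x = ∑ y, M n y c + r := by
    simp only [Finset.mul_sum]
    rw [Finset.sum_comm]
    simp only [hM.sum_upper_mul_lower j _ hj, Finset.sum_add_distrib]
    simp
  have h2 : ∑ w, M (n + 1) w j * 2 ≤ ∑ w, M (n + 1) w j * ∑ x, M (n + 1) w x := by
    refine Finset.sum_le_sum fun w _ => ?_
    rcases hM.zero_or_one _ w j with h | h
    · simp [h]
    · rw [h, one_mul, one_mul]; exact hdeg w h
  rw [← Finset.sum_mul, hM.sum_upper_of_coversOnly hj, h1] at h2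
  linarith

/-- Two elements covering only `c` are the beginnings of two disjoint saturated chains whose
elements cover only one element each. -/
theorem exists_chains {m : ℕ} {c : P m} (hc : ∑ y, M m y c ≤ r + 1) {a b : P (m + 1)} (hab : a ≠ b)
    (ha : CoversOnly M a c) (hb : CoversOnly M b c) (d : ℕ) :
    ∃ x y : P (m + d + 1), x ≠ y ∧
      (∃ z : P (m + d), CoversOnly M x z ∧ ∑ t, M _ t z ≤ r + 1) ∧
      (∃ z : P (m + d), CoversOnly M y z ∧ ∑ t, M _ t z ≤ r + 1) ∧
      (∀ j ≤ d, upDownPow M j _ x y = 0) ∧ upDownPow M (d + 1) _ x y = 1 := by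
  induction d with
  | zero =>
    refine ⟨a, b, hab, ⟨c, ha, hc⟩, ⟨c, hb, hc⟩, ?_, ?_⟩
    · intro j hj
      obtain rfl : j = 0 := by omega
      simp [hab]
    · exact (upDownPow_succ_apply M ha hb).trans (by simp)
  | succ d ih =>
    obtain ⟨x, y, hxy, ⟨z, hz, hz'⟩, ⟨t, ht, ht'⟩, h0, h1⟩ := ih
    obtain ⟨x', hx'⟩ := hM.exists_coversOnly hz hz'
    obtain ⟨y', hy'⟩ := hM.exists_coversOnly ht ht'
    have hne : x' ≠ y' := by
      rintro rfl
      have := hx' x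
      rw [hy' x, if_neg hxy] at this
      simp at this
    -- The degree bound reproduces itself: an element covering only one element has exactly `r + 1`
    -- upper covers.
    refine ⟨x', y', hne, ⟨x, hx', (hM.sum_upper_of_coversOnly hz).le⟩,
      ⟨y, hy', (hM.sum_upper_of_coversOnly ht).le⟩, ?_, ?_⟩
    · rintro (_ | j) hj
      · simp [hne]
      · exact (upDownPow_succ_apply M hx' hy').trans (h0 j (by omega))
    · exact (upDownPow_succ_apply M hx' hy').trans h1

theorem exists_pair {m : ℕ} {c : P m} (hc : ∑ y, M m y c ≤ r + 1)
    (hcard : 1 < Fintype.card (P (m + 1))) (hcov : ∀ a : P (m + 1), CoversOnly M a c) {n d : ℕ}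
    (hn : n = m + d + 1) :
    ∃ x y : P n, (∀ j < d + 1, upDownPow M j n x y = 0) ∧ upDownPow M (d + 1) n x y = 1 := by
  subst hn
  obtain ⟨a, b, hab⟩ := Fintype.exists_pair_of_one_lt_card hcard
  obtain ⟨x, y, -, -, -, h0, h1⟩ := hM.exists_chains hc hab (hcov a) (hcov b) d
  exact ⟨x, y, fun j hj => h0 j (by omega), h1⟩

/-! ### The lowest ranks -/

theorem coversOnly_of_card_eq_one {n : ℕ} (h : Fintype.card (P n) = 1) (y : P (n + 1)) (x : P n) :
    CoversOnly M y x := by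
  have := Fintype.card_le_one_iff_subsingleton.mp h.le
  intro z
  obtain ⟨t, ht⟩ := hM.exists_lower n y
  rw [if_pos (Subsingleton.elim _ _), ← ht, Subsingleton.elim z t]

theorem card_succ_of_card_eq_one {n : ℕ} (h : Fintype.card (P n) = 1) (x : P n) :
    (Fintype.card (P (n + 1)) : ℤ) = ∑ y, M n y x := by
  have : ∀ y, M n y x = 1 := fun y => by simp [hM.coversOnly_of_card_eq_one h y x x]
  simp [this]

theorem sum_upper_zero (x : P 0) : ∑ y, M 0 y x = r := by
  have h := congrFun (congrFun hM.down_up_zero x) x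
  simpa [Matrix.mul_apply, hM.mul_self] using h

theorem card_one : Fintype.card (P 1) = r := by
  obtain ⟨x, -⟩ := Fintype.card_eq_one_iff.mp hM.card_zero
  have := hM.card_succ_of_card_eq_one hM.card_zero x
  rw [hM.sum_upper_zero] at this
  exact_mod_cast this

/-- If the next rank were empty, `DU` would be zero, yet `UD + r` has positive diagonal. A last
Smith entry requires a nonempty index set. -/
theorem nonempty (n : ℕ) : Nonempty (P n) := by
  induction n with
  | zero => exact Fintype.card_pos_iff.mp (by rw [hM.card_zero]; exact one_pos)
  | succ n ih =>
    cases n with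
    | zero => exact Fintype.card_pos_iff.mp (by rw [hM.card_one]; exact hM.pos)
    | succ n =>
      obtain ⟨x⟩ := ih
      by_contra hempty
      rw [not_nonempty_iff] at hempty
      have h := congrFun (congrFun (hM.down_up_succ n) x) x
      have hr : (0 : ℤ) < r := by exact_mod_cast hM.pos
      have : 0 ≤ (M n * (M n)ᵀ) x x := by
        rw [Matrix.mul_apply]
        exact Finset.sum_nonneg fun z _ => mul_self_nonneg _
      rw [Matrix.mul_apply, Matrix.add_apply, Matrix.smul_apply, Matrix.one_apply_eq] at h
      simp at h
      linarith

/-- For `r ≥ 2` a multiple of the inverse of `DU + k` with an entry `1`. -/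
theorem exists_mul_eq_of_two_le (hr : 2 ≤ r) (n : ℕ) (k : ℤ) :
    ∃ (C : Matrix (P n) (P n) ℤ) (N : ℤ) (x y : P n),
      ((M n)ᵀ * M n + k • (1 : Matrix (P n) (P n) ℤ)) * C = N • 1 ∧
        Associated N (rkFactorial r k (n + 1)) ∧ C x y = 1 := by
  obtain ⟨x, y, h0, h1⟩ : ∃ x y : P n, (∀ j < n, upDownPow M j n x y = 0) ∧
      upDownPow M n n x y = 1 := by
    obtain ⟨c, -⟩ := Fintype.card_eq_one_iff.mp hM.card_zero
    cases n with
    | zero => exact ⟨c, c, by simp, by simp⟩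
    | succ n =>
      -- The chains start in rank 1, whose `r ≥ 2` elements all cover only the bottom.
      exact hM.exists_pair (c := c) (by rw [hM.sum_upper_zero]; simp) (by rw [hM.card_one]; omega)
        (fun a => hM.coversOnly_of_card_eq_one hM.card_zero a c) (by rw [Nat.zero_add])
  refine ⟨shiftedInverse M r k n (n + 1), -((-1) ^ (n + 1) * rkFactorial r k (n + 1)), x, y,
    ?_, ?_, ?_⟩
  · rw [hM.add_mul_shiftedInverse, upDownPow_eq_zero M (Nat.lt_succ_self n)]
    simp
  · rcases neg_one_pow_eq_or ℤ (n + 1) with h | h <;> rw [h] <;> simp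
  -- At `(x, y)` only the leading term `U^n D^n` contributes.
  · simp [-zsmul_eq_mul, shiftedInverse, h1, shiftedInverse_apply_eq_zero M r k h0 le_rfl]

/-- On rank 1, a single element over a single element, `UD = 1` and `DU = 2`. Each further rank adds
1 to the factor. -/
theorem down_up_mul_upDownPow_of_eq_one (hr : r = 1) (n : ℕ) :
    (M (n + 1))ᵀ * M (n + 1) * upDownPow M n (n + 1) =
      ((n : ℤ) + 2) • upDownPow M n (n + 1) := by
  induction n with
  | zero =>
    have h1 : Fintype.card (P 1) = 1 := hM.card_one.trans hr
    have := Fintype.card_le_one_iff_subsingleton.mp h1.le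
    obtain ⟨c, -⟩ := Fintype.card_eq_one_iff.mp hM.card_zero
    rw [hM.down_up_succ, hr, upDownPow_zero, mul_one]
    ext x y
    obtain rfl := Subsingleton.elim x y
    have hx := hM.coversOnly_of_card_eq_one hM.card_zero x c
    have := Fintype.card_le_one_iff_subsingleton.mp hM.card_zero.le
    rw [Matrix.add_apply, Matrix.smul_apply, Matrix.smul_apply]
    simp [Matrix.mul_apply, hx _]
  | succ n ih =>
    rw [hM.down_up_succ]
    calc (M (n + 1) * (M (n + 1))ᵀ + (r : ℤ) • 1) * upDownPow M (n + 1) (n + 2)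
        = M (n + 1) * ((M (n + 1))ᵀ * M (n + 1) * upDownPow M n (n + 1)) * (M (n + 1))ᵀ
            + (r : ℤ) • upDownPow M (n + 1) (n + 2) := by
          simp only [add_mul, upDownPow, smul_mul_assoc, one_mul, Matrix.mul_assoc]
      _ = _ := by
          rw [ih, hr]
          simp only [upDownPow, Matrix.mul_smul, Matrix.smul_mul]
          push_cast
          module

/-- For `r = 1` a multiple of the inverse of `DU + k` with an entry `1`. -/
theorem exists_mul_eq_of_eq_one (hr : r = 1) (n : ℕ) (k : ℤ) :
    ∃ (C : Matrix (P n) (P n) ℤ) (N : ℤ) (x y : P n),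
      ((M n)ᵀ * M n + k • (1 : Matrix (P n) (P n) ℤ)) * C = N • 1 ∧
        Associated N (rkFactorial 1 k (n - 1) * ((n : ℤ) + 1 + k)) ∧ C x y = 1 := by
  cases n with
  | zero =>
    obtain ⟨c, -⟩ := Fintype.card_eq_one_iff.mp hM.card_zero
    refine ⟨1, 1 + k, c, c, ?_, ?_, by simp⟩
    · rw [hM.down_up_zero, hr, mul_one]; push_cast; module
    -- Truncated subtraction makes `0 - 1` give the empty product, in agreement with `(-1)! = 1`.
    · simp [rkFactorial]
  | succ n =>
    have h1 : Fintype.card (P 1) = 1 := hM.card_one.trans hr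
    obtain ⟨c, -⟩ := Fintype.card_eq_one_iff.mp h1
    obtain ⟨c₀, -⟩ := Fintype.card_eq_one_iff.mp hM.card_zero
    have hc : ∑ y, M 1 y c = r + 1 :=
      hM.sum_upper_of_coversOnly (hM.coversOnly_of_card_eq_one hM.card_zero c c₀)
    obtain ⟨x, y, h0, h1⟩ : ∃ x y : P (n + 1), (∀ j < n, upDownPow M j (n + 1) x y = 0) ∧
        upDownPow M n (n + 1) x y = 1 := by
      cases n with
      | zero => exact ⟨c, c, by simp, by simp⟩
      | succ n =>
        -- Rank 1 has no two elements to start from, so the chains begin one rank higher, over the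
        -- unique element of rank 1.
        have h2 : Fintype.card (P 2) = 2 := by
          have := hM.card_succ_of_card_eq_one h1 c
          rw [hc, hr] at this
          exact_mod_cast this
        exact hM.exists_pair hc.le (h2 ▸ one_lt_two) (fun a => hM.coversOnly_of_card_eq_one h1 a c)
          (by omega)
    -- `DU + k` multiplies `U^n D^n` by `n + 2 + k`; subtracting that multiple of `shiftedInverse`
    -- cancels `U^n D^n` and leaves a scalar.
    refine ⟨upDownPow M n (n + 1) - ((n : ℤ) + 2 + k) • shiftedInverse M r k (n + 1) n,
      (-1) ^ n * rkFactorial r k n * ((n : ℤ) + 2 + k), x, y, ?_, ?_, ?_⟩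
    · rw [mul_sub, mul_smul_comm, hM.add_mul_shiftedInverse, add_mul,
        hM.down_up_mul_upDownPow_of_eq_one hr, smul_mul_assoc, one_mul]
      module
    · rw [hr]
      have : ((n + 1 : ℕ) : ℤ) + 1 + k = (n : ℤ) + 2 + k := by push_cast; ring
      rw [this, Nat.add_sub_cancel]
      rcases neg_one_pow_eq_or ℤ n with h | h <;> rw [h] <;> simp
    · simp [-zsmul_eq_mul, h1, shiftedInverse_apply_eq_zero M r k h0 le_rfl]

end IsDifferentialPoset

/-! ### Completeness of the irreducible characters -/

open scoped MonoidAlgebra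

/-- Choosing a basis moves a simple module to some `ℂ^d`, where its character is an `IrrChar`. -/
theorem exists_character_of_isSimpleModule {G : Type*} [Group G] [Finite G] (V : Type*)
    [AddCommGroup V] [Module ℂ V] [Module ℂ[G] V] [IsScalarTower ℂ ℂ[G] V]
    [FiniteDimensional ℂ V] [IsSimpleModule ℂ[G] V] :
    ∃ (d : ℕ) (ρ : Representation ℂ G (Fin d → ℂ)) (e : V ≃ₗ[ℂ] (Fin d → ℂ)), ρ.IsIrreducible ∧
      ∀ z v, ρ.asAlgebraHom z (e v) = e (z • v) := by
  let e : V ≃ₗ[ℂ] (Fin (Module.finrank ℂ V) → ℂ) := (Module.finBasis ℂ V).equivFun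
  let Φ : ℂ[G] →ₐ[ℂ] Module.End ℂ (Fin (Module.finrank ℂ V) → ℂ) :=
    (e.conjAlgEquiv ℂ).toAlgHom.comp (Algebra.lsmul ℂ ℂ V)
  let ρ : Representation ℂ G (Fin (Module.finrank ℂ V) → ℂ) :=
    (Φ : ℂ[G] →* Module.End ℂ (Fin (Module.finrank ℂ V) → ℂ)).comp (MonoidAlgebra.of ℂ G)
  have hΦ : ρ.asAlgebraHom = Φ := by
    exact (MonoidAlgebra.lift ℂ _ G).apply_symm_apply Φ
  have hact : ∀ z v, ρ.asAlgebraHom z (e v) = e (z • v) := fun z v => by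
    rw [hΦ]
    simp [Φ, LinearEquiv.conjAlgEquiv_apply]
  refine ⟨_, ρ, e, ?_, hact⟩
  rw [Representation.irreducible_iff_isSimpleModule_asModule]
  let E : V ≃ₗ[ℂ[G]] ρ.asModule :=
    { toFun := fun v => ρ.asModuleEquiv.symm (e v)
      invFun := fun x => e.symm (ρ.asModuleEquiv x)
      left_inv := fun v => by simp
      right_inv := fun x => by simp
      map_add' := fun v w => by simp
      map_smul' := fun z v => by
        apply ρ.asModuleEquiv.injective
        rw [RingHom.id_apply, Representation.asModuleEquiv_map_smul]
        simp [hact] }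
  exact IsSimpleModule.congr E.symm

/-- Schur's lemma for class functions. -/
theorem sum_smul_eq_zero_of_sum_character_eq_zero {G V : Type*} [Group G] [Fintype G]
    [AddCommGroup V] [Module ℂ V] [FiniteDimensional ℂ V] (ρ : Representation ℂ G V)
    [ρ.IsIrreducible] {f : G → ℂ} (hf : ∀ g h, f (h * g * h⁻¹) = f g)
    (h0 : ∑ g, f g * ρ.character g⁻¹ = 0) : ∑ g, f g • ρ g⁻¹ = 0 := by
  have hcomm : ∀ h, (∑ g, f g • ρ g⁻¹) ∘ₗ ρ h = ρ h ∘ₗ ∑ g, f g • ρ g⁻¹ := by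
    intro h
    change (∑ g, f g • ρ g⁻¹) * ρ h = ρ h * ∑ g, f g • ρ g⁻¹
    rw [Finset.sum_mul, Finset.mul_sum]
    refine Fintype.sum_equiv (MulAut.conj h⁻¹).toEquiv _ _ fun g => ?_
    change f g • ρ g⁻¹ * ρ h = ρ h * f (h⁻¹ * g * h⁻¹⁻¹) • ρ (h⁻¹ * g * h⁻¹⁻¹)⁻¹
    rw [hf, smul_mul_assoc, mul_smul_comm, ← map_mul, ← map_mul]
    congr 2
    group
  let T : Representation.IntertwiningMap ρ ρ := ⟨∑ g, f g • ρ g⁻¹, hcomm⟩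
  obtain ⟨c, hc⟩ :=
    (Representation.IsIrreducible.algebraMap_intertwiningMap_bijective_of_isAlgClosed
      (ρ := ρ)).2 T
  have hT : ∑ g, f g • ρ g⁻¹ = c • (1 : Module.End ℂ V) :=
    (congrArg Representation.IntertwiningMap.toLinearMap hc).symm
  -- The trace of the scalar `c` is `c` times the nonzero dimension, and it vanishes by `h0`.
  have htr := congrArg (LinearMap.trace ℂ V) hT
  rw [map_sum, map_smul, LinearMap.trace_one] at htr
  simp only [map_smul, smul_eq_mul] at htr
  rw [show ∑ g, f g * LinearMap.trace ℂ V (ρ g⁻¹) = 0 from h0] at htr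
  have hV : Nontrivial V := by
    obtain ⟨a, b, hab⟩ := exists_pair_ne (Subrepresentation ρ)
    by_contra hV
    rw [not_nontrivial_iff_subsingleton] at hV
    exact hab (Subrepresentation.toSubmodule_injective (Subsingleton.elim _ _))
  have hd : (Module.finrank ℂ V : ℂ) ≠ 0 := by
    exact_mod_cast (Module.finrank_pos (R := ℂ) (M := V)).ne'
  rw [hT, (mul_eq_zero.mp htr.symm).resolve_right hd, zero_smul]

/-- By Schur, `∑ f(g) g⁻¹` kills every simple quotient of the group algebra, so it lies in the
Jacobson radical, which is zero by semisimplicity. -/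
theorem eq_zero_of_charPairing_eq_zero {G : Type*} [Group G] [Fintype G] {f : G → ℂ}
    (hf : ∀ g h, f (h * g * h⁻¹) = f g) (h0 : ∀ χ : IrrChar G, charPairing f χ.1 = 0) : f = 0 := by
  have hcard : (Fintype.card G : ℂ) ≠ 0 := by simp
  let z : ℂ[G] := ∑ g, MonoidAlgebra.single g⁻¹ (f g)
  have hz : z ∈ Module.jacobson ℂ[G] ℂ[G] := by
    rw [Module.jacobson, Submodule.mem_sInf]
    intro m hm
    have : IsSimpleModule ℂ[G] (ℂ[G] ⧸ m) := isSimpleModule_iff_isCoatom.mpr hm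
    have : FiniteDimensional ℂ ℂ[G] := inferInstance
    obtain ⟨d, ρ, e, hρ, he⟩ := exists_character_of_isSimpleModule (G := G) (ℂ[G] ⧸ m)
    have h := h0 ⟨ρ.character, d, ρ, hρ, rfl⟩
    have h' := (mul_eq_zero.mp h).resolve_left (inv_ne_zero hcard)
    have hzero := sum_smul_eq_zero_of_sum_character_eq_zero ρ hf h'
    have hz' : ρ.asAlgebraHom z = 0 := by
      rw [map_sum, ← hzero]
      exact Finset.sum_congr rfl fun g _ => Representation.asAlgebraHom_single ρ _ _
    have := he z (Submodule.Quotient.mk 1)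
    rw [hz', LinearMap.zero_apply, eq_comm, LinearEquiv.map_eq_zero_iff, ← Submodule.Quotient.mk_smul,
      Submodule.Quotient.mk_eq_zero, smul_eq_mul, mul_one] at this
    exact this
  have hbot : Module.jacobson ℂ[G] ℂ[G] = ⊥ := IsSemisimpleRing.jacobson_eq_bot _
  rw [hbot, Submodule.mem_bot] at hz
  funext g
  have := congrArg (fun z : ℂ[G] => z.coeff g⁻¹) hz
  simp only [z, MonoidAlgebra.coeff_sum, Finsupp.finsetSum_apply, MonoidAlgebra.coeff_single,
    MonoidAlgebra.coeff_zero, Finsupp.zero_apply] at this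
  rw [Finset.sum_eq_single g (fun b _ hb => Finsupp.single_eq_of_ne (by simpa using hb.symm))
    (by simp), Finsupp.single_eq_same] at this
  exact this

/-! ### Restriction and induction of characters -/

section Characters

variable {H G : Type*} [Group H] [Fintype H] [Group G] [Fintype G]

theorem IrrChar.conj_apply {G : Type*} [Group G] (χ : IrrChar G) (g h : G) : χ.1 (h * g * h⁻¹) = χ.1 g := by
  obtain ⟨_, d, ρ, hρ, rfl⟩ := χ
  exact ρ.char_conj g h

theorem IrrChar.one_apply_ne_zero {G : Type*} [Group G] (χ : IrrChar G) : χ.1 1 ≠ 0 := by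
  obtain ⟨_, d, ρ, hρ, rfl⟩ := χ
  have hd : d ≠ 0 := by
    rintro rfl
    obtain ⟨a, b, hab⟩ := exists_pair_ne (Subrepresentation ρ)
    exact hab (Subrepresentation.toSubmodule_injective (Subsingleton.elim _ _))
  simpa using hd

theorem charPairing_comm (φ χ : G → ℂ) : charPairing φ χ = charPairing χ φ := by
  unfold charPairing
  congr 1
  refine Fintype.sum_equiv (Equiv.inv G) _ _ fun g => ?_
  simp [mul_comm]

theorem charPairing_sum_smul {α : Type*} (s : Finset α) (c : α → ℂ) (f : α → G → ℂ) (χ : G → ℂ) :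
    charPairing (∑ a ∈ s, c a • f a) χ = ∑ a ∈ s, c a * charPairing (f a) χ := by
  simp only [charPairing, Finset.sum_apply, Pi.smul_apply, smul_eq_mul, Finset.sum_mul,
    Finset.mul_sum]
  rw [Finset.sum_comm]
  refine Finset.sum_congr rfl fun a _ => Finset.sum_congr rfl fun g _ => by ring

theorem charPairing_sub (φ φ' χ : G → ℂ) :
    charPairing (φ - φ') χ = charPairing φ χ - charPairing φ' χ := by
  simp only [charPairing, Pi.sub_apply, sub_mul, Finset.sum_sub_distrib, mul_sub]

theorem charPairing_smul (c : ℂ) (φ χ : G → ℂ) :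
    charPairing (c • φ) χ = c * charPairing φ χ := by
  simp only [charPairing, Pi.smul_apply, smul_eq_mul, mul_assoc, ← Finset.mul_sum]
  ring

theorem IrrChar.charPairing_eq (χ ψ : IrrChar G) :
    charPairing χ.1 ψ.1 = if χ = ψ then 1 else 0 := by
  split_ifs with h
  · exact (charPairing_irrChar χ ψ).1 h
  · exact (charPairing_irrChar χ ψ).2 h

/-- A class function is the combination of the irreducible characters with its multiplicities as
coefficients. -/
theorem sum_charPairing_smul {f : G → ℂ} (hf : ∀ g h, f (h * g * h⁻¹) = f g) :
    ∑ χ : IrrChar G, charPairing f χ.1 • χ.1 = f := by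
  rw [eq_comm, ← sub_eq_zero]
  refine eq_zero_of_charPairing_eq_zero (fun g h => ?_) fun ψ => ?_
  · simp [hf, IrrChar.conj_apply]
  · rw [charPairing_sub, charPairing_sum_smul]
    simp [IrrChar.charPairing_eq]

open Classical in
theorem indChar_conj (i : H →* G) (φ : H → ℂ) (g h : G) :
    indChar i φ (h * g * h⁻¹) = indChar i φ g := by
  unfold indChar
  congr 1
  refine Fintype.sum_equiv (Equiv.mulLeft h⁻¹) _ _ fun x => ?_
  refine Finset.sum_congr rfl fun y _ => ?_
  have : x⁻¹ * (h * g * h⁻¹) * x = (h⁻¹ * x)⁻¹ * g * (h⁻¹ * x) := by group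
  exact if_congr (by rw [this]; rfl) rfl rfl

open Classical in
/-- Frobenius reciprocity. -/
theorem charPairing_indChar (i : H →* G) (φ : H → ℂ) {ψ : G → ℂ}
    (hψ : ∀ g h, ψ (h * g * h⁻¹) = ψ g) :
    charPairing (indChar i φ) ψ = charPairing φ (resChar i ψ) := by
  have hG : (Fintype.card G : ℂ) ≠ 0 := by simp
  have key : ∑ g, (∑ x : G, ∑ h : H, if x⁻¹ * g * x = i h then φ h else 0) * ψ g⁻¹ =
      Fintype.card G * ∑ h, φ h * ψ (i h⁻¹) := by
    simp only [Finset.sum_mul]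
    rw [Finset.sum_comm]
    have hx : ∀ x : G, ∑ g, ∑ h : H, (if x⁻¹ * g * x = i h then φ h else 0) * ψ g⁻¹ =
        ∑ h, φ h * ψ (i h⁻¹) := by
      intro x
      rw [Finset.sum_comm]
      refine Finset.sum_congr rfl fun h _ => ?_
      -- For fixed `x` and `h` only this conjugate contributes, so the inner sum is independent of
      -- `x`.
      rw [Finset.sum_eq_single (x * i h * x⁻¹)]
      · rw [if_pos (by group), ← hψ (i h⁻¹) x, map_inv]
        congr 2
        group
      · intro g _ hg
        rw [if_neg, zero_mul]
        intro hgh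
        exact hg (by rw [← hgh]; group)
      · simp
    rw [Finset.sum_congr rfl fun x _ => hx x, Finset.sum_const, Finset.card_univ, nsmul_eq_mul]
  unfold charPairing indChar resChar
  rw [Finset.sum_congr rfl fun g _ => mul_assoc _ _ _, ← Finset.mul_sum, key]
  field_simp

theorem card_irrChar_of_subsingleton [Subsingleton G] : Fintype.card (IrrChar G) = 1 := by
  have hpair : ∀ φ χ : G → ℂ, charPairing φ χ = φ 1 * χ 1 := fun φ χ => by
    have hu : (Finset.univ : Finset G) = {1} :=
      Finset.eq_singleton_iff_unique_mem.mpr ⟨Finset.mem_univ _, fun x _ => Subsingleton.elim _ _⟩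
    simp [charPairing, Fintype.card_eq_one_iff.mpr ⟨1, fun x : G => Subsingleton.elim x 1⟩, hu]
  refine le_antisymm (Fintype.card_le_one_iff.mpr fun χ ψ => ?_) (Fintype.card_pos_iff.mpr ?_)
  · by_contra hne
    have h := (charPairing_irrChar χ ψ).2 hne
    rw [hpair] at h
    exact mul_ne_zero χ.one_apply_ne_zero ψ.one_apply_ne_zero h
  · by_contra hempty
    rw [not_nonempty_iff] at hempty
    have h := congrFun (sum_charPairing_smul (f := fun _ : G => 1) fun _ _ => rfl) 1
    simp at h

end Characters

/-! ### The branching poset of a differential tower -/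

section Tower

variable {r : ℕ} {G : ℕ → Type*} [∀ n, Group (G n)] [∀ n, Fintype (G n)]
  {i : ∀ n, G n →* G (n + 1)}

omit [∀ n, Fintype (G n)] in
theorem BranchingPoset.elt_injective {n : ℕ} {χ χ' : IrrChar (G n)}
    (h : BranchingPoset.elt i n χ = BranchingPoset.elt i n χ') : χ = χ' :=
  eq_of_heq (Sigma.mk.inj h).2

theorem branchingStep_elt_iff {n : ℕ} {χ : IrrChar (G n)} {ψ : IrrChar (G (n + 1))} :
    BranchingStep i (BranchingPoset.elt i n χ) (BranchingPoset.elt i (n + 1) ψ) ↔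
      charPairing (resChar (i n) ψ.1) χ.1 ≠ 0 := by
  refine ⟨fun h => ?_, BranchingStep.mk n χ ψ⟩
  generalize ha : BranchingPoset.elt i n χ = a at h
  generalize hb : BranchingPoset.elt i (n + 1) ψ = b at h
  obtain ⟨m, χ', ψ', h⟩ := h
  obtain rfl : n = m := congrArg Sigma.fst ha
  obtain rfl := BranchingPoset.elt_injective ha
  obtain rfl := BranchingPoset.elt_injective hb
  exact h

theorem upMatrix_apply (n : ℕ) (ψ : IrrChar (G (n + 1))) (χ : IrrChar (G n)) [Decidable
    (charPairing (resChar (i n) ψ.1) χ.1 = 0)] :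
    upMatrix i n ψ χ = if charPairing (resChar (i n) ψ.1) χ.1 = 0 then 0 else 1 := by
  simp only [upMatrix, Matrix.of_apply, branching_covBy_iff, branchingStep_elt_iff]
  split_ifs <;> simp_all

/-- Multiplicity-freeness is what lets the 0/1 covering matrix record the actual multiplicities. -/
theorem IsDifferentialTower.charPairing_resChar (hG : IsDifferentialTower r i) {n : ℕ}
    (ψ : IrrChar (G (n + 1))) (χ : IrrChar (G n)) :
    charPairing (resChar (i n) ψ.1) χ.1 = (upMatrix i n ψ χ : ℂ) := by
  classical
  rw [upMatrix_apply]
  rcases hG.multiplicity_free n ψ χ with h | h <;> simp [h]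

theorem IsDifferentialTower.resChar_eq_sum (hG : IsDifferentialTower r i) {n : ℕ}
    (ψ : IrrChar (G (n + 1))) :
    resChar (i n) ψ.1 = ∑ χ : IrrChar (G n), (upMatrix i n ψ χ : ℂ) • χ.1 := by
  rw [← sum_charPairing_smul (f := resChar (i n) ψ.1)]
  · simp only [hG.charPairing_resChar]
  · intro g h
    simp [resChar, ψ.conj_apply]

theorem IsDifferentialTower.indChar_eq_sum (hG : IsDifferentialTower r i) {n : ℕ}
    (χ : IrrChar (G n)) :
    indChar (i n) χ.1 = ∑ ψ : IrrChar (G (n + 1)), (upMatrix i n ψ χ : ℂ) • ψ.1 := by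
  rw [← sum_charPairing_smul (indChar_conj (i n) χ.1)]
  refine Finset.sum_congr rfl fun ψ _ => ?_
  rw [charPairing_indChar _ _ ψ.conj_apply, charPairing_comm, hG.charPairing_resChar]

theorem IsDifferentialTower.charPairing_resChar_indChar (hG : IsDifferentialTower r i) {n : ℕ}
    (χ χ' : IrrChar (G n)) :
    charPairing (resChar (i n) (indChar (i n) χ.1)) χ'.1 =
      (((upMatrix i n)ᵀ * upMatrix i n) χ' χ : ℤ) := by
  have h : resChar (i n) (indChar (i n) χ.1) =
      ∑ ψ : IrrChar (G (n + 1)), (upMatrix i n ψ χ : ℂ) • resChar (i n) ψ.1 := by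
    rw [hG.indChar_eq_sum]
    funext g
    simp [resChar]
  rw [h, charPairing_sum_smul]
  simp [hG.charPairing_resChar, Matrix.mul_apply, mul_comm]

theorem IsDifferentialTower.charPairing_indChar_resChar (hG : IsDifferentialTower r i) {n : ℕ}
    (ψ ψ' : IrrChar (G (n + 1))) :
    charPairing (indChar (i n) (resChar (i n) ψ.1)) ψ'.1 =
      ((upMatrix i n * (upMatrix i n)ᵀ) ψ' ψ : ℤ) := by
  rw [charPairing_indChar _ _ ψ'.conj_apply, hG.resChar_eq_sum ψ, charPairing_sum_smul]
  simp only [charPairing_comm _ (resChar (i n) ψ'.1), hG.charPairing_resChar]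
  simp [Matrix.mul_apply, mul_comm]

theorem IrrChar.mem_virtualChars {G : Type*} [Group G] (χ : IrrChar G) : χ.1 ∈ virtualChars G :=
  Submodule.subset_span ⟨χ, rfl⟩

theorem IsDifferentialTower.isDifferentialPoset (hG : IsDifferentialTower r i) :
    IsDifferentialPoset r (P := fun n => IrrChar (G n)) (upMatrix i) where
  pos := hG.pos
  card_zero := by
    have := hG.trivial
    exact card_irrChar_of_subsingleton
  zero_or_one n ψ χ := by
    classical
    rw [upMatrix_apply]
    split_ifs <;> simp
  exists_lower n ψ := by
    classical
    by_contra! hno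
    have hzero : ∀ χ, upMatrix i n ψ χ = 0 := fun χ => by
      have := hno χ
      rw [upMatrix_apply] at this ⊢
      split_ifs at this ⊢ <;> simp_all
    -- Without lower elements the restriction of `ψ` would vanish, but its value at 1 is nonzero.
    have h := congrFun (hG.resChar_eq_sum ψ) 1
    simp [resChar, hzero, ψ.one_apply_ne_zero] at h
  down_up_zero := by
    ext χ' χ
    have h := congrArg (charPairing · χ'.1) (hG.res_ind_zero χ.1 χ.mem_virtualChars)
    simp only [hG.charPairing_resChar_indChar, charPairing_smul, χ.charPairing_eq] at h
    rw [Matrix.smul_apply, Matrix.one_apply]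
    simp only [eq_comm (a := χ')]
    split_ifs at h ⊢ <;> simp only [mul_one, mul_zero] at h <;> simp <;> exact_mod_cast h
  down_up_succ n := by
    ext χ' χ
    have h := congrArg (charPairing · χ'.1) (hG.res_ind_succ n χ.1 χ.mem_virtualChars)
    simp only [charPairing_sub, hG.charPairing_resChar_indChar, hG.charPairing_indChar_resChar,
      charPairing_smul, χ.charPairing_eq] at h
    rw [Matrix.add_apply, Matrix.smul_apply, Matrix.one_apply]
    simp only [eq_comm (a := χ')]
    rw [sub_eq_iff_eq_add'] at h
    split_ifs at h ⊢ <;> simp only [mul_one, mul_zero, add_zero] at h <;> simp <;> exact_mod_cast h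

end Tower

theorem theorem6p12 (r : ℕ) {G : ℕ → Type*} [∀ n, Group (G n)] [∀ n, Fintype (G n)]
    (i : ∀ n, G n →* G (n + 1)) (hG : IsDifferentialTower r i) (n : ℕ) (k : ℤ)
    (A : Matrix (IrrChar (G n)) (IrrChar (G n)) ℤ)
    (hA : A = downUpMatrix i n + k • (1 : Matrix (IrrChar (G n)) (IrrChar (G n)) ℤ)) :
    (A.det = 0 → ∀ s : ℤ, IsLastSmithEntry A s ↔ s = 0) ∧
    (A.det ≠ 0 → 2 ≤ r →
      ∀ s : ℤ, IsLastSmithEntry A s ↔ Associated s (rkFactorial r k (n + 1))) ∧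
    (A.det ≠ 0 → r = 1 →
      ∀ s : ℤ, IsLastSmithEntry A s ↔
        Associated s (rkFactorial 1 k (n - 1) * ((n : ℤ) + 1 + k))) := by
  have hM := hG.isDifferentialPoset
  have : Nonempty (IrrChar (G n)) := hM.nonempty n
  -- `downMatrix` is the transpose of `upMatrix` by definition.
  have hA' : A = (upMatrix i n)ᵀ * upMatrix i n + k • 1 := hA
  refine ⟨isLastSmithEntry_iff_eq_zero, fun hdet hr s => ?_, fun hdet hr s => ?_⟩
  · obtain ⟨C, N, x, y, hC, hN, hxy⟩ := hM.exists_mul_eq_of_two_le hr n k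
    rw [isLastSmithEntry_iff_associated hdet (hA' ▸ hC) (hxy ▸ isUnit_one)]
    exact ⟨fun h => h.trans hN, fun h => h.trans hN.symm⟩
  · obtain ⟨C, N, x, y, hC, hN, hxy⟩ := hM.exists_mul_eq_of_eq_one hr n k
    rw [isLastSmithEntry_iff_associated hdet (hA' ▸ hC) (hxy ▸ isUnit_one)]
    exact ⟨fun h => h.trans hN, fun h => h.trans hN.symm⟩

end
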